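/- Let $\Gamma=\mathcal Q_d$ be the $d$-dimensional hypercube graph: its vertex set $X$ is $\{1,-1\}^d$, and two vertices are adjacent when they differ in exactly one coordinate. It is distance-regular with diameter $d$ and path-length distance $\partial$. Fix $x\in X$. Let $p^h_{ij}$ be the intersection numbers ($p^h_{ij}=|\{z:\partial(y,z)=i,\ \partial(y',z)=j\}|$ for any $y,y'$ with $\partial(y,y')=h$). Let $A_i$ be the $i$th distance matrix, let $\theta_0>\cdots>\theta_d$ be the distinct eigenvalues of the adjacency matrix, and let $E_i$ be the matrix acting as $1$ on the $\theta_i$-eigenspace and as $0$ on the other eigenspaces. Let $E_i^*$ and $A_i^*$ be the diagonal matrices with $(E_i^*)_{yy}=1$ if $\partial(x,y)=i$ and $0$ otherwise, and $(A_i^*)_{yy}=|X|(E_i)_{xy}$. Define scalars $(p^h_{ij})^*$, $q_i(j)$, $q_i^*(j)$ by $$E_i\circ E_j=|X|^{-1}\sum_{h=0}^d (p^h_{ij})^*E_h,\qquad E_i=|X|^{-1}\sum_{j=0}^d q_i(j)A_j,\qquad E_i^*=|X|^{-1}\sum_{j=0}^d q_i^*(j)A_j^*,$$ where $\circ$ is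 the entrywise product. Let $\mathcal T_d$ be the generalized Terwilliger algebra of $\mathcal Q_d$: the unital associative $\mathbb C$-algebra with generators $x_0,\dots,x_d,x_0^*,\dots,x_d^*$ and relations, for $0\le h,i,j\le d$, $$x_0=x_0^*=1,\qquad x_ix_j=\sum_{h=0}^d p^h_{ij}x_h,\qquad x_i^*x_j^*=\sum_{h=0}^d (p^h_{ij})^*x_h^*,$$ $$e_h^*x_ie_j^*=0\ \text{ if } p^h_{ij}=0,\qquad e_hx_i^*e_j=0\ \text{ if } (p^h_{ij})^*=0,$$ where $e_i=|X|^{-1}\sum_{j=0}^d q_i(j)x_j$ and $e_i^*=|X|^{-1}\sum_{j=0}^d q_i^*(j)x_j^*$. With $k_i=p^0_{ii}$ and $k_i^*=(p^0_{ii})^*$, the primary central idempotent $u_0\in\mathcal T_d$ is the common value of $$2^d\sum_{i=0}^d k_i^{-1}e_i^*e_0e_i^*\qquad\text{and}\qquad 2^d\sum_{i=0}^d (k_i^*)^{-1}e_ie_0^*e_i .$$ **Proposition.** For $d=1$, $u_0=1$ (that is, both expressions above equal $1$). Moreover, the algebra $\mathcal T_1$ is isomorphic to $M_2(\mathbb C)$.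 -/

import Mathlib

/-! Distance-regular graphs, their parameters, and the generalized Terwilliger algebra.

All definitions below are meant for a connected distance-regular graph `Γ` on a nonempty finite
vertex set `X`; `d = Γ.diam` is its diameter. Families indexed by `0, …, d` are functions on `ℕ`
of which only the values at `0, …, d` are used. -/

namespace GenTerwilliger

/-- The intersection number `p^h_{ij}`: for vertices `x, y` at distance `h`, the number of
vertices `z` with `∂(x,z) = i` and `∂(y,z) = j`. In a distance-regular graph this number is the same
for all such `x, y`, so the supremum below is the common value. -/
noncomputable def interNum {X : Type} [Fintype X] (Γ : SimpleGraph X) (h i j : ℕ) : ℕ :=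
  (Finset.univ.filter fun w : X × X => Γ.dist w.1 w.2 = h).sup fun w =>
    (Finset.univ.filter fun z : X => Γ.dist w.1 z = i ∧ Γ.dist w.2 z = j).card

/-- The adjacency matrix `A` over `ℂ`. -/
noncomputable def adjA {X : Type} (Γ : SimpleGraph X) : Matrix X X ℂ :=
  open scoped Classical in Γ.adjMatrix ℂ

/-- The distance matrix `A_i`. -/
noncomputable def distMatrix {X : Type} (Γ : SimpleGraph X) (i : ℕ) : Matrix X X ℂ :=
  Matrix.of fun y z => if Γ.dist y z = i then 1 else 0

/-- The distinct eigenvalues `θ_0 > θ_1 > ⋯ > θ_d` of `A` (all real, `A` being symmetric). -/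
noncomputable def eigenvalue {X : Type} [Fintype X] [DecidableEq X] (Γ : SimpleGraph X) (i : ℕ) :
    ℝ :=
  ((Matrix.finite_real_spectrum (A := adjA Γ)).toFinset.sort (· ≥ ·)).getD i 0

/-- `M` acts as the identity on the `μ`-eigenspace of `A`, and as zero on all other eigenspaces. -/
def IsEigenProjection {X : Type} [Fintype X] (Γ : SimpleGraph X) (μ : ℂ) (M : Matrix X X ℂ) :
    Prop :=
  (∀ v : X → ℂ, (adjA Γ).mulVec v = μ • v → M.mulVec v = v) ∧
    ∀ ν : ℂ, ν ≠ μ → ∀ v : X → ℂ, (adjA Γ).mulVec v = ν • v → M.mulVec v = 0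

/-- The primitive idempotent `E_i` associated with `θ_i` (`0 ≤ i ≤ d`): the matrix, unique because
`A` is diagonalizable, acting as `1` on the `θ_i`-eigenspace and as `0` on the others. -/
noncomputable def primIdem {X : Type} [Fintype X] [DecidableEq X] (Γ : SimpleGraph X) (i : ℕ) :
    Matrix X X ℂ :=
  Classical.epsilon fun M => IsEigenProjection Γ (eigenvalue Γ i : ℂ) M

/-- The dual primitive idempotent `E_i^*(x)`. -/
noncomputable def dualPrimIdem {X : Type} [DecidableEq X] (Γ : SimpleGraph X) (x : X) (i : ℕ) :
    Matrix X X ℂ :=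
  Matrix.diagonal fun y => if Γ.dist x y = i then 1 else 0

/-- The dual distance matrix `A_i^*(x)`: diagonal, with `(y,y)`-entry `|X| (E_i)_{xy}`. -/
noncomputable def dualDistMatrix {X : Type} [Fintype X] [DecidableEq X] (Γ : SimpleGraph X) (x : X)
    (i : ℕ) : Matrix X X ℂ :=
  Matrix.diagonal fun y => (Fintype.card X : ℂ) * primIdem Γ i x y

/-- The coefficients `c 0, …, c d` of `M = ∑_{j=0}^d c j • B j` in terms of the family
`B 0, …, B d`; they exist and are unique when `B 0, …, B d` is a basis of a space containing `M`. -/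
noncomputable def coeffs {X : Type} (d : ℕ) (B : ℕ → Matrix X X ℂ) (M : Matrix X X ℂ) : ℕ → ℂ :=
  Classical.epsilon fun c => M = ∑ j ∈ Finset.range (d + 1), c j • B j

/-- The Krein parameter `(p^h_{ij})^*`, given by
`E_i ∘ E_j = |X|⁻¹ ∑_{h=0}^d (p^h_{ij})^* E_h` where `∘` is the entrywise product. -/
noncomputable def krein {X : Type} [Fintype X] [DecidableEq X] (Γ : SimpleGraph X) (h i j : ℕ) :
    ℂ :=
  coeffs Γ.diam (primIdem Γ)
    ((Fintype.card X : ℂ) • Matrix.hadamard (primIdem Γ i) (primIdem Γ j)) h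

/-- The scalar `q_i(j)`, given by `E_i = |X|⁻¹ ∑_{j=0}^d q_i(j) A_j`. -/
noncomputable def qCoeff {X : Type} [Fintype X] [DecidableEq X] (Γ : SimpleGraph X) (i j : ℕ) : ℂ :=
  coeffs Γ.diam (distMatrix Γ) ((Fintype.card X : ℂ) • primIdem Γ i) j

/-- The scalar `q_i^*(j)`, given by `E_i^* = |X|⁻¹ ∑_{j=0}^d q_i^*(j) A_j^*`. -/
noncomputable def qStarCoeff {X : Type} [Fintype X] [DecidableEq X] (Γ : SimpleGraph X) (x : X)
    (i j : ℕ) : ℂ :=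
  coeffs Γ.diam (dualDistMatrix Γ x) ((Fintype.card X : ℂ) • dualPrimIdem Γ x i) j

/-- The free algebra on symbols `x_0, …, x_d` (left summand) and `x_0^*, …, x_d^*` (right). -/
abbrev Free {X : Type} (Γ : SimpleGraph X) : Type :=
  FreeAlgebra ℂ (Fin (Γ.diam + 1) ⊕ Fin (Γ.diam + 1))

/-- The generator `x_i`; zero for `i > d`. -/
noncomputable def fX {X : Type} (Γ : SimpleGraph X) (i : ℕ) : Free Γ :=
  if hi : i < Γ.diam + 1 then FreeAlgebra.ι ℂ (Sum.inl ⟨i, hi⟩) else 0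

/-- The generator `x_i^*`; zero for `i > d`. -/
noncomputable def fXStar {X : Type} (Γ : SimpleGraph X) (i : ℕ) : Free Γ :=
  if hi : i < Γ.diam + 1 then FreeAlgebra.ι ℂ (Sum.inr ⟨i, hi⟩) else 0

/-- `e_i = |X|⁻¹ ∑_{j=0}^d q_i(j) x_j`. -/
noncomputable def fE {X : Type} [Fintype X] [DecidableEq X] (Γ : SimpleGraph X) (i : ℕ) : Free Γ :=
  (Fintype.card X : ℂ)⁻¹ • ∑ j ∈ Finset.range (Γ.diam + 1), qCoeff Γ i j • fX Γ j

/-- `e_i^* = |X|⁻¹ ∑_{j=0}^d q_i^*(j) x_j^*`. -/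
noncomputable def fEStar {X : Type} [Fintype X] [DecidableEq X] (Γ : SimpleGraph X) (x : X)
    (i : ℕ) : Free Γ :=
  (Fintype.card X : ℂ)⁻¹ • ∑ j ∈ Finset.range (Γ.diam + 1), qStarCoeff Γ x i j • fXStar Γ j

/-- The defining relations of the generalized Terwilliger algebra. -/
inductive Rel {X : Type} [Fintype X] [DecidableEq X] (Γ : SimpleGraph X) (x : X) :
    Free Γ → Free Γ → Prop
  | one : Rel Γ x (fX Γ 0) 1
  | one_star : Rel Γ x (fXStar Γ 0) 1
  | mul (i j : ℕ) (hi : i ≤ Γ.diam) (hj : j ≤ Γ.diam) :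
      Rel Γ x (fX Γ i * fX Γ j)
        (∑ h ∈ Finset.range (Γ.diam + 1), (interNum Γ h i j : ℂ) • fX Γ h)
  | mul_star (i j : ℕ) (hi : i ≤ Γ.diam) (hj : j ≤ Γ.diam) :
      Rel Γ x (fXStar Γ i * fXStar Γ j)
        (∑ h ∈ Finset.range (Γ.diam + 1), krein Γ h i j • fXStar Γ h)
  | triple (h i j : ℕ) (hh : h ≤ Γ.diam) (hi : i ≤ Γ.diam) (hj : j ≤ Γ.diam)
      (hp : interNum Γ h i j = 0) :
      Rel Γ x (fEStar Γ x h * fX Γ i * fEStar Γ x j) 0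
  | triple_star (h i j : ℕ) (hh : h ≤ Γ.diam) (hi : i ≤ Γ.diam) (hj : j ≤ Γ.diam)
      (hp : krein Γ h i j = 0) :
      Rel Γ x (fE Γ h * fXStar Γ i * fE Γ j) 0

/-- The generalized Terwilliger algebra of `Γ`, where `x` is the fixed base vertex. -/
abbrev GTAlg {X : Type} [Fintype X] [DecidableEq X] (Γ : SimpleGraph X) (x : X) : Type :=
  RingQuot (Rel Γ x)

/-- The element `e_i` of the generalized Terwilliger algebra. -/
noncomputable def e {X : Type} [Fintype X] [DecidableEq X] (Γ : SimpleGraph X) (x : X) (i : ℕ) :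
    GTAlg Γ x :=
  RingQuot.mkAlgHom ℂ (Rel Γ x) (fE Γ i)

/-- The element `e_i^*` of the generalized Terwilliger algebra. -/
noncomputable def eStar {X : Type} [Fintype X] [DecidableEq X] (Γ : SimpleGraph X) (x : X) (i : ℕ) :
    GTAlg Γ x :=
  RingQuot.mkAlgHom ℂ (Rel Γ x) (fEStar Γ x i)

/-- The hypercube `𝒬_d`: vertices are the `d`-tuples over `ℤˣ = {1, -1}`, adjacent when they differ
in exactly one coordinate. -/
def cube (d : ℕ) : SimpleGraph (Fin d → ℤˣ) where
  Adj a b := hammingDist a b = 1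
  symm := ⟨fun a b h => by rw [hammingDist_comm]; exact h⟩
  loopless := ⟨fun a h => by simp at h⟩

/-- `𝒯_d`, the generalized Terwilliger algebra of `𝒬_d` (with base vertex `x`). -/
abbrev cubeAlg (d : ℕ) (x : Fin d → ℤˣ) : Type := GTAlg (cube d) x

/-- The primary central idempotent `u_0 = 2^d ∑_{i=0}^d k_i⁻¹ e_i^* e_0 e_i^*` of `𝒯_d`, where
`k_i = p^0_{ii}` is the `i`th valency. -/
noncomputable def u0 (d : ℕ) (x : Fin d → ℤˣ) : cubeAlg d x :=
  (2 : ℂ) ^ d • ∑ i ∈ Finset.range (d + 1),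
    (interNum (cube d) 0 i i : ℂ)⁻¹ • (eStar (cube d) x i * e (cube d) x 0 * eStar (cube d) x i)

/-- The dual expression `2^d ∑_{i=0}^d (k_i^*)⁻¹ e_i e_0^* e_i` of the primary central idempotent,
where `k_i^* = (p^0_{ii})^*` is the `i`th dual valency. -/
noncomputable def u0Dual (d : ℕ) (x : Fin d → ℤˣ) : cubeAlg d x :=
  (2 : ℂ) ^ d • ∑ i ∈ Finset.range (d + 1),
    (krein (cube d) 0 i i)⁻¹ • (e (cube d) x i * eStar (cube d) x 0 * e (cube d) x i)

end GenTerwilliger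

namespace GenTerwilliger

/-! Since `𝒬_1` is the complete graph on two vertices, `A² = 1`, the eigenvalues are `1, -1`, and
`E_0, E_1 = (1 ± A)/2`. Intersection numbers and Krein parameters are both the structure constants
of the group of order two (`interNum_cube_one`, `krein_cube_one`), and the scalars `q_i(j)`,
`q_i^*(j)` are all `±1`.

Hence `𝒯_1` is generated by two involutions, `x_1` and `x_1^*`. The relations `e_h^* x_1 e_h^* = 0`
say that the compressions of `x_1` to both "eigenspaces" of `x_1^*` vanish, which amounts to
anticommutation (`genXStar_mul_genX`). Conversely, anticommuting involutions satisfy every defining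
relation (`rel_cube_one_of_involutions`). So `𝒯_1` is the quaternion algebra with `i² = j² = 1`, and
this is split: `i` and `j` act as anticommuting involutions in `M_2(ℂ)`, and `1, i, j, ij` go to a
basis. Both formulas for `u_0` reduce to `1` by anticommutation alone. -/

theorem eq_or_eq_neg_of_fin_one (y z : Fin 1 → ℤˣ) : z = y ∨ z = -y := by
  revert y z; decide

theorem neg_ne_self_of_fin_one (y : Fin 1 → ℤˣ) : -y ≠ y := by
  revert y; decide

theorem sum_fin_one_units {M : Type*} [AddCommMonoid M] (f : (Fin 1 → ℤˣ) → M) (y : Fin 1 → ℤˣ) :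
    ∑ w, f w = f y + f (-y) := by
  have h : (Finset.univ : Finset (Fin 1 → ℤˣ)) = {y, -y} := by revert y; decide
  rw [h, Finset.sum_pair (neg_ne_self_of_fin_one y).symm]

theorem card_fin_one_units : Fintype.card (Fin 1 → ℤˣ) = 2 := by decide

/-! ### Distances and intersection numbers of `𝒬_1`. -/

theorem cube_one_eq_top : cube 1 = ⊤ := by
  ext a b
  change hammingDist a b = 1 ↔ a ≠ b
  revert a b; decide

theorem dist_cube_one (a b : Fin 1 → ℤˣ) : (cube 1).dist a b = if a = b then 0 else 1 := by
  rw [cube_one_eq_top]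
  split_ifs with h
  · simp [h]
  · exact SimpleGraph.dist_top_of_ne h

theorem diam_cube_one : (cube 1).diam = 1 := by
  rw [cube_one_eq_top]
  have : Nontrivial (Fin 1 → ℤˣ) := ⟨_, _, neg_ne_self_of_fin_one 1⟩
  exact SimpleGraph.diam_top

/-- For `h, i, j ≤ 1` the intersection number of `𝒬_1` is `1` when `h + i + j` is even. -/
theorem interNum_cube_one {h i j : ℕ} (hh : h ≤ 1) (hi : i ≤ 1) (hj : j ≤ 1) :
    interNum (cube 1) h i j = if (h + i + j) % 2 = 0 then 1 else 0 := by
  simp only [interNum, dist_cube_one]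
  interval_cases h <;> interval_cases i <;> interval_cases j <;> decide

/-! ### Spectrum and primitive idempotents. -/

theorem adjA_cube_one_apply (y z : Fin 1 → ℤˣ) :
    adjA (cube 1) y z = if y = z then 0 else 1 := by
  simp [adjA, cube_one_eq_top, SimpleGraph.adjMatrix_apply]

theorem distMatrix_cube_one_zero : distMatrix (cube 1) 0 = 1 := by
  ext y z
  by_cases h : y = z <;> simp [distMatrix, dist_cube_one, Matrix.one_apply, h]

theorem distMatrix_cube_one_one : distMatrix (cube 1) 1 = adjA (cube 1) := by
  ext y z
  by_cases h : y = z <;> simp [distMatrix, dist_cube_one, adjA_cube_one_apply, h]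

theorem adjA_cube_one_mul_self : adjA (cube 1) * adjA (cube 1) = 1 := by
  ext y z
  rw [Matrix.mul_apply, sum_fin_one_units _ y]
  have hn := neg_ne_self_of_fin_one y
  rcases eq_or_eq_neg_of_fin_one y z with rfl | rfl <;>
    simp [adjA_cube_one_apply, hn, hn.symm]

theorem smul_one_add_smul_adjA_cube_one_eq_zero {a b : ℂ}
    (h : a • (1 : Matrix (Fin 1 → ℤˣ) (Fin 1 → ℤˣ) ℂ) + b • adjA (cube 1) = 0) :
    a = 0 ∧ b = 0 := by
  have h0 := congrFun₂ h 1 1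
  have h1 := congrFun₂ h 1 (-1)
  have hn := (neg_ne_self_of_fin_one 1).symm
  simp only [Matrix.add_apply, Matrix.smul_apply, Matrix.one_apply, adjA_cube_one_apply, if_true,
    if_neg hn, smul_eq_mul, Matrix.zero_apply] at h0 h1
  exact ⟨by simpa using h0, by simpa using h1⟩

/-- As `A² = 1`, `(r - A)(r + A) = r² - 1`. If `r² ≠ 1` this is a unit, hence so is its factor `r -
A`. If `r = ±1`, then `r - A` annihilates a nonzero combination of `1` and `A`. -/
theorem spectrum_adjA_cube_one : spectrum ℝ (adjA (cube 1)) = {1, -1} := by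
  have hA := adjA_cube_one_mul_self
  have key : ∀ a b : ℂ, a • (1 : Matrix (Fin 1 → ℤˣ) (Fin 1 → ℤˣ) ℂ) + b • adjA (cube 1) = 0 →
      b = 0 := fun a b h => (smul_one_add_smul_adjA_cube_one_eq_zero h).2
  ext r
  rw [spectrum.mem_iff, Set.mem_insert_iff, Set.mem_singleton_iff]
  constructor
  · intro h
    by_contra hr
    rw [not_or] at hr
    apply h
    have hr2 : r * r - 1 ≠ 0 := by
      intro h0
      have : (r - 1) * (r + 1) = 0 := by linear_combination h0
      rcases mul_eq_zero.1 this with h1 | h1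
      · exact hr.1 (by linarith)
      · exact hr.2 (by linarith)
    have hc : Commute (algebraMap ℝ (Matrix (Fin 1 → ℤˣ) (Fin 1 → ℤˣ) ℂ) r - adjA (cube 1))
        (algebraMap ℝ (Matrix (Fin 1 → ℤˣ) (Fin 1 → ℤˣ) ℂ) r + adjA (cube 1)) := by
      have := Algebra.commutes r (adjA (cube 1))
      simp only [commute_iff_eq, mul_add, add_mul, sub_mul, mul_sub, this]
      abel
    have hp : (algebraMap ℝ (Matrix (Fin 1 → ℤˣ) (Fin 1 → ℤˣ) ℂ) r - adjA (cube 1)) *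
        (algebraMap ℝ (Matrix (Fin 1 → ℤˣ) (Fin 1 → ℤˣ) ℂ) r + adjA (cube 1)) =
        algebraMap ℝ _ (r * r - 1) := by
      have := Algebra.commutes r (adjA (cube 1))
      rw [map_sub, map_mul, map_one, mul_add, sub_mul, sub_mul, hA, this]
      abel
    have hu : IsUnit (algebraMap ℝ (Matrix (Fin 1 → ℤˣ) (Fin 1 → ℤˣ) ℂ) (r * r - 1)) :=
      (IsUnit.mk0 _ hr2).map _
    rw [← hp] at hu
    exact (hc.isUnit_mul_iff.1 hu).1
  · rintro (rfl | rfl) hu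
    · have h0 : (algebraMap ℝ (Matrix (Fin 1 → ℤˣ) (Fin 1 → ℤˣ) ℂ) 1 - adjA (cube 1)) *
          (1 + adjA (cube 1)) = 0 := by
        rw [map_one, mul_add, sub_mul, sub_mul, hA]
        simp
      rw [hu.mul_right_eq_zero] at h0
      exact one_ne_zero (key 1 1 (by simpa using h0))
    · have h0 : (algebraMap ℝ (Matrix (Fin 1 → ℤˣ) (Fin 1 → ℤˣ) ℂ) (-1) - adjA (cube 1)) *
          (1 - adjA (cube 1)) = 0 := by
        rw [map_neg, map_one, mul_sub, sub_mul, sub_mul, hA]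
        noncomm_ring
      rw [hu.mul_right_eq_zero] at h0
      exact neg_ne_zero.2 one_ne_zero (key 1 (-1) (by simpa [sub_eq_add_neg] using h0))

theorem sort_eigenvalues_cube_one :
    (Matrix.finite_real_spectrum (A := adjA (cube 1))).toFinset.sort (· ≥ ·) = [1, -1] := by
  have h : (Matrix.finite_real_spectrum (A := adjA (cube 1))).toFinset = {1, -1} := by
    ext r
    simp [spectrum_adjA_cube_one]
  rw [h]
  have h2 : ([1, -1] : List ℝ).toFinset = {1, -1} := by simp
  rw [← h2]
  apply (List.toFinset_sort (r := (· ≥ ·)) (by norm_num)).2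
  norm_num

theorem eigenvalue_cube_one_zero : eigenvalue (cube 1) 0 = 1 := by
  simp [eigenvalue, sort_eigenvalues_cube_one]

theorem eigenvalue_cube_one_one : eigenvalue (cube 1) 1 = -1 := by
  simp [eigenvalue, sort_eigenvalues_cube_one]

/-- When `A² = 1` and `μ = ±1`, the projection onto the `μ`-eigenspace is `(1 + μ A) / 2`. -/
theorem isEigenProjection_iff_of_mul_self {X : Type} [Fintype X] [DecidableEq X]
    {Γ : SimpleGraph X} (hA : adjA Γ * adjA Γ = 1) {μ : ℂ} (hμ : μ * μ = 1) (M : Matrix X X ℂ) :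
    IsEigenProjection Γ μ M ↔ M = (2 : ℂ)⁻¹ • (1 + μ • adjA Γ) := by
  have hAv (v : X → ℂ) : (adjA Γ).mulVec ((adjA Γ).mulVec v) = v := by
    rw [Matrix.mulVec_mulVec, hA, Matrix.one_mulVec]
  have hμ0 : μ ≠ -μ := by
    intro h
    have : μ = 0 := by linear_combination h / 2
    simp [this] at hμ
  constructor
  · rintro ⟨h1, h2⟩
    apply Matrix.mulVec_injective
    funext v
    -- The vectors `v ± μAv` are eigenvectors for `±μ` (or zero) and sum to `2v`, so `M v` is
    -- determined.
    have e1 := h1 (v + μ • (adjA Γ).mulVec v) (by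
      rw [Matrix.mulVec_add, Matrix.mulVec_smul, hAv, smul_add, smul_smul, hμ, one_smul, add_comm])
    have e2 := h2 (-μ) hμ0.symm (v - μ • (adjA Γ).mulVec v) (by
      rw [Matrix.mulVec_sub, Matrix.mulVec_smul, hAv, smul_sub, smul_smul, neg_mul, hμ]
      module)
    rw [Matrix.mulVec_add] at e1
    rw [Matrix.mulVec_sub] at e2
    rw [Matrix.smul_mulVec, Matrix.add_mulVec, Matrix.one_mulVec, Matrix.smul_mulVec, ← e1,
      sub_eq_zero.1 e2, ← two_smul ℂ, smul_smul, ← sub_eq_zero.1 e2]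
    simp
  · rintro rfl
    refine ⟨fun v hv => ?_, fun ν hν v hv => ?_⟩
    · rw [Matrix.smul_mulVec, Matrix.add_mulVec, Matrix.one_mulVec, Matrix.smul_mulVec, hv,
        smul_smul, hμ, one_smul, ← two_smul ℂ, smul_smul]
      simp
    · have h := hAv v
      rw [hv, Matrix.mulVec_smul, hv, smul_smul] at h
      rw [Matrix.smul_mulVec, Matrix.add_mulVec, Matrix.one_mulVec, Matrix.smul_mulVec, hv]
      funext y
      have hy := congrFun h y
      simp only [Pi.smul_apply, Pi.add_apply, Pi.zero_apply, smul_eq_mul] at hy ⊢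
      -- `A² = 1` gives `ν² v = v`; with `μ² = 1` the left side is `μ(ν² - 1) v y`. No case split on
      -- whether `ν` is an eigenvalue is needed.
      have : (ν - μ) * ((1 + μ * ν) * v y) = 0 := by
        linear_combination μ * hy - ν * v y * hμ
      have := (mul_eq_zero.1 this).resolve_left (sub_ne_zero.2 hν)
      linear_combination (2 : ℂ)⁻¹ * this

theorem primIdem_eq_of_mul_self {X : Type} [Fintype X] [DecidableEq X]
    {Γ : SimpleGraph X} (hA : adjA Γ * adjA Γ = 1) {i : ℕ} {μ : ℂ}
    (h : (eigenvalue Γ i : ℂ) = μ) (hμ : μ * μ = 1) :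
    primIdem Γ i = (2 : ℂ)⁻¹ • (1 + μ • adjA Γ) := by
  rw [primIdem, h]
  simp only [isEigenProjection_iff_of_mul_self hA hμ]
  exact Classical.epsilon_spec (⟨_, rfl⟩ : ∃ M, M = (2 : ℂ)⁻¹ • (1 + μ • adjA Γ))

theorem primIdem_cube_one_zero :
    primIdem (cube 1) 0 = (2 : ℂ)⁻¹ • (1 + adjA (cube 1)) := by
  rw [primIdem_eq_of_mul_self adjA_cube_one_mul_self (μ := 1)
    (by simp [eigenvalue_cube_one_zero]) (by norm_num), one_smul]

theorem primIdem_cube_one_one :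
    primIdem (cube 1) 1 = (2 : ℂ)⁻¹ • (1 - adjA (cube 1)) := by
  rw [primIdem_eq_of_mul_self adjA_cube_one_mul_self (μ := -1)
    (by simp [eigenvalue_cube_one_one]) (by norm_num), neg_smul, one_smul, sub_eq_add_neg]

/-! ### The scalars `q_i(j)`, `q_i^*(j)` and the Krein parameters. -/

/-- An expansion exists, so the chosen coefficients satisfy it; independence then forces them to be
the given ones. -/
theorem coeffs_one_eq {X : Type} {B : ℕ → Matrix X X ℂ} {M : Matrix X X ℂ} {a b : ℂ}
    (hB : ∀ s t : ℂ, s • B 0 + t • B 1 = 0 → s = 0 ∧ t = 0) (hM : M = a • B 0 + b • B 1) :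
    coeffs 1 B M 0 = a ∧ coeffs 1 B M 1 = b := by
  have h : M = ∑ j ∈ Finset.range (1 + 1), coeffs 1 B M j • B j :=
    Classical.epsilon_spec (p := fun c : ℕ → ℂ => M = ∑ j ∈ Finset.range (1 + 1), c j • B j)
      ⟨fun j => if j = 0 then a else b, by simp [Finset.sum_range_succ, hM]⟩
  rw [Finset.sum_range_succ, Finset.sum_range_one] at h
  have h0 := hB (coeffs 1 B M 0 - a) (coeffs 1 B M 1 - b) (by
    have h' := h.symm.trans hM
    rw [sub_smul, sub_smul, sub_add_sub_comm, h', sub_self])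
  exact ⟨sub_eq_zero.1 h0.1, sub_eq_zero.1 h0.2⟩

theorem distMatrix_cube_one_independent (s t : ℂ)
    (h : s • distMatrix (cube 1) 0 + t • distMatrix (cube 1) 1 = 0) : s = 0 ∧ t = 0 := by
  rw [distMatrix_cube_one_zero, distMatrix_cube_one_one] at h
  exact smul_one_add_smul_adjA_cube_one_eq_zero h

theorem primIdem_cube_one_independent (s t : ℂ)
    (h : s • primIdem (cube 1) 0 + t • primIdem (cube 1) 1 = 0) : s = 0 ∧ t = 0 := by
  rw [primIdem_cube_one_zero, primIdem_cube_one_one] at h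
  have h' := smul_one_add_smul_adjA_cube_one_eq_zero (a := (s + t) / 2) (b := (s - t) / 2)
    (by rw [← h]; module)
  exact ⟨by linear_combination h'.1 + h'.2, by linear_combination h'.1 - h'.2⟩

theorem dualDistMatrix_cube_one_zero (x : Fin 1 → ℤˣ) :
    dualDistMatrix (cube 1) x 0 = Matrix.diagonal fun _ => 1 := by
  rw [dualDistMatrix, primIdem_cube_one_zero, card_fin_one_units]
  congr 1
  funext y
  by_cases h : x = y <;> simp [adjA_cube_one_apply, h]

theorem dualDistMatrix_cube_one_one (x : Fin 1 → ℤˣ) :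
    dualDistMatrix (cube 1) x 1 = Matrix.diagonal fun y => if x = y then 1 else -1 := by
  rw [dualDistMatrix, primIdem_cube_one_one, card_fin_one_units]
  congr 1
  funext y
  by_cases h : x = y <;> simp [adjA_cube_one_apply, h]

theorem dualDistMatrix_cube_one_independent (x : Fin 1 → ℤˣ) (s t : ℂ)
    (h : s • dualDistMatrix (cube 1) x 0 + t • dualDistMatrix (cube 1) x 1 = 0) :
    s = 0 ∧ t = 0 := by
  rw [dualDistMatrix_cube_one_zero, dualDistMatrix_cube_one_one] at h
  have h0 := congrFun₂ h x x
  have h1 := congrFun₂ h (-x) (-x)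
  have hn := (neg_ne_self_of_fin_one x).symm
  simp [hn] at h0 h1
  exact ⟨by linear_combination h0 / 2 + h1 / 2, by linear_combination h0 / 2 - h1 / 2⟩

theorem qCoeff_cube_one_zero : qCoeff (cube 1) 0 0 = 1 ∧ qCoeff (cube 1) 0 1 = 1 := by
  rw [qCoeff, qCoeff, diam_cube_one]
  apply coeffs_one_eq distMatrix_cube_one_independent
  rw [primIdem_cube_one_zero, distMatrix_cube_one_zero, distMatrix_cube_one_one,
    card_fin_one_units]
  module

theorem qCoeff_cube_one_one : qCoeff (cube 1) 1 0 = 1 ∧ qCoeff (cube 1) 1 1 = -1 := by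
  rw [qCoeff, qCoeff, diam_cube_one]
  apply coeffs_one_eq distMatrix_cube_one_independent
  rw [primIdem_cube_one_one, distMatrix_cube_one_zero, distMatrix_cube_one_one,
    card_fin_one_units]
  module

theorem qStarCoeff_cube_one_zero (x : Fin 1 → ℤˣ) :
    qStarCoeff (cube 1) x 0 0 = 1 ∧ qStarCoeff (cube 1) x 0 1 = 1 := by
  rw [qStarCoeff, qStarCoeff, diam_cube_one]
  apply coeffs_one_eq (dualDistMatrix_cube_one_independent x)
  rw [dualDistMatrix_cube_one_zero, dualDistMatrix_cube_one_one, dualPrimIdem,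
    card_fin_one_units, ← Matrix.diagonal_smul, ← Matrix.diagonal_smul, ← Matrix.diagonal_smul,
    Matrix.diagonal_add]
  congr 1
  funext y
  by_cases h : x = y <;> simp [dist_cube_one, h]
  norm_num

theorem qStarCoeff_cube_one_one (x : Fin 1 → ℤˣ) :
    qStarCoeff (cube 1) x 1 0 = 1 ∧ qStarCoeff (cube 1) x 1 1 = -1 := by
  rw [qStarCoeff, qStarCoeff, diam_cube_one]
  apply coeffs_one_eq (dualDistMatrix_cube_one_independent x)
  rw [dualDistMatrix_cube_one_zero, dualDistMatrix_cube_one_one, dualPrimIdem,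
    card_fin_one_units, ← Matrix.diagonal_smul, ← Matrix.diagonal_smul, ← Matrix.diagonal_smul,
    Matrix.diagonal_add]
  congr 1
  funext y
  by_cases h : x = y <;> simp [dist_cube_one, h]
  norm_num

/-- For `h, i, j ≤ 1` the Krein parameter of `𝒬_1` is `1` when `h + i + j` is even. -/
theorem krein_cube_one {h i j : ℕ} (hh : h ≤ 1) (hi : i ≤ 1) (hj : j ≤ 1) :
    krein (cube 1) h i j = if (h + i + j) % 2 = 0 then 1 else 0 := by
  have key : krein (cube 1) 0 i j = (if (0 + i + j) % 2 = 0 then 1 else 0) ∧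
      krein (cube 1) 1 i j = (if (1 + i + j) % 2 = 0 then 1 else 0) := by
    rw [krein, krein, diam_cube_one]
    apply coeffs_one_eq primIdem_cube_one_independent
    rw [card_fin_one_units]
    ext y z
    interval_cases i <;> interval_cases j <;> by_cases hyz : y = z <;>
      simp [primIdem_cube_one_zero, primIdem_cube_one_one, adjA_cube_one_apply, hyz]
  interval_cases h
  · exact key.1
  · exact key.2

/-! ### Generators and relations of `𝒯_1`, and the value of `u_0`. -/

theorem sum_range_diam_cube_one {M : Type*} [AddCommMonoid M] (f : ℕ → M) :
    ∑ j ∈ Finset.range ((cube 1).diam + 1), f j = f 0 + f 1 := by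
  rw [diam_cube_one, Finset.sum_range_succ, Finset.sum_range_one]

theorem fE_cube_one_zero : fE (cube 1) 0 = (2 : ℂ)⁻¹ • (fX (cube 1) 0 + fX (cube 1) 1) := by
  rw [fE, sum_range_diam_cube_one, qCoeff_cube_one_zero.1, qCoeff_cube_one_zero.2,
    card_fin_one_units, one_smul, one_smul, Nat.cast_ofNat]

theorem fE_cube_one_one : fE (cube 1) 1 = (2 : ℂ)⁻¹ • (fX (cube 1) 0 - fX (cube 1) 1) := by
  rw [fE, sum_range_diam_cube_one, qCoeff_cube_one_one.1, qCoeff_cube_one_one.2,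
    card_fin_one_units, one_smul, neg_smul, one_smul, Nat.cast_ofNat, sub_eq_add_neg]

theorem fEStar_cube_one_zero (x : Fin 1 → ℤˣ) :
    fEStar (cube 1) x 0 = (2 : ℂ)⁻¹ • (fXStar (cube 1) 0 + fXStar (cube 1) 1) := by
  rw [fEStar, sum_range_diam_cube_one, (qStarCoeff_cube_one_zero x).1,
    (qStarCoeff_cube_one_zero x).2, card_fin_one_units, one_smul, one_smul, Nat.cast_ofNat]

theorem fEStar_cube_one_one (x : Fin 1 → ℤˣ) :
    fEStar (cube 1) x 1 = (2 : ℂ)⁻¹ • (fXStar (cube 1) 0 - fXStar (cube 1) 1) := by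
  rw [fEStar, sum_range_diam_cube_one, (qStarCoeff_cube_one_one x).1,
    (qStarCoeff_cube_one_one x).2, card_fin_one_units, one_smul, neg_smul, one_smul,
    Nat.cast_ofNat, sub_eq_add_neg]

/-- The image of the generator `x_1` in `𝒯_1`. -/
noncomputable def genX (x : Fin 1 → ℤˣ) : cubeAlg 1 x :=
  RingQuot.mkAlgHom ℂ (Rel (cube 1) x) (fX (cube 1) 1)

/-- The image of the generator `x_1^*` in `𝒯_1`. -/
noncomputable def genXStar (x : Fin 1 → ℤˣ) : cubeAlg 1 x :=
  RingQuot.mkAlgHom ℂ (Rel (cube 1) x) (fXStar (cube 1) 1)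

theorem mkAlgHom_fX_zero (x : Fin 1 → ℤˣ) :
    RingQuot.mkAlgHom ℂ (Rel (cube 1) x) (fX (cube 1) 0) = 1 := by
  rw [RingQuot.mkAlgHom_rel ℂ (Rel.one (Γ := cube 1) (x := x)), map_one]

theorem mkAlgHom_fXStar_zero (x : Fin 1 → ℤˣ) :
    RingQuot.mkAlgHom ℂ (Rel (cube 1) x) (fXStar (cube 1) 0) = 1 := by
  rw [RingQuot.mkAlgHom_rel ℂ (Rel.one_star (Γ := cube 1) (x := x)), map_one]

theorem e_cube_one_zero (x : Fin 1 → ℤˣ) : e (cube 1) x 0 = (2 : ℂ)⁻¹ • (1 + genX x) := by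
  rw [e, fE_cube_one_zero, map_smul, map_add, mkAlgHom_fX_zero, genX]

theorem e_cube_one_one (x : Fin 1 → ℤˣ) : e (cube 1) x 1 = (2 : ℂ)⁻¹ • (1 - genX x) := by
  rw [e, fE_cube_one_one, map_smul, map_sub, mkAlgHom_fX_zero, genX]

theorem eStar_cube_one_zero (x : Fin 1 → ℤˣ) :
    eStar (cube 1) x 0 = (2 : ℂ)⁻¹ • (1 + genXStar x) := by
  rw [eStar, fEStar_cube_one_zero, map_smul, map_add, mkAlgHom_fXStar_zero, genXStar]

theorem eStar_cube_one_one (x : Fin 1 → ℤˣ) :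
    eStar (cube 1) x 1 = (2 : ℂ)⁻¹ • (1 - genXStar x) := by
  rw [eStar, fEStar_cube_one_one, map_smul, map_sub, mkAlgHom_fXStar_zero, genXStar]

theorem genX_mul_self (x : Fin 1 → ℤˣ) : genX x * genX x = 1 := by
  have h := RingQuot.mkAlgHom_rel ℂ
    (Rel.mul (Γ := cube 1) (x := x) 1 1 diam_cube_one.ge diam_cube_one.ge)
  rw [map_mul, sum_range_diam_cube_one, interNum_cube_one zero_le_one le_rfl le_rfl,
    interNum_cube_one le_rfl le_rfl le_rfl] at h
  rw [genX, h]
  simp [mkAlgHom_fX_zero]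

theorem genXStar_mul_self (x : Fin 1 → ℤˣ) : genXStar x * genXStar x = 1 := by
  have h := RingQuot.mkAlgHom_rel ℂ
    (Rel.mul_star (Γ := cube 1) (x := x) 1 1 diam_cube_one.ge diam_cube_one.ge)
  rw [map_mul, sum_range_diam_cube_one, krein_cube_one zero_le_one le_rfl le_rfl,
    krein_cube_one le_rfl le_rfl le_rfl] at h
  rw [genXStar, h]
  simp [mkAlgHom_fXStar_zero]

/-- The off-diagonal terms cancel in the sum of the two compressions, leaving `(p + qpq)/2`.
Multiplying `p + qpq = 0` on the right by `q` gives the claim. -/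
theorem mul_eq_neg_mul_of_compressions {B : Type*} [Ring B] [Algebra ℂ B] {p q : B}
    (hq : q * q = 1)
    (h0 : (2 : ℂ)⁻¹ • (1 + q) * p * ((2 : ℂ)⁻¹ • (1 + q)) = 0)
    (h1 : (2 : ℂ)⁻¹ • (1 - q) * p * ((2 : ℂ)⁻¹ • (1 - q)) = 0) : q * p = -(p * q) := by
  have h : (2 : ℂ) • (p + q * p * q) = 0 := by
    have : (2 : ℂ) • (p + q * p * q) =
        (4 : ℂ) • ((2 : ℂ)⁻¹ • (1 + q) * p * ((2 : ℂ)⁻¹ • (1 + q)) +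
          (2 : ℂ)⁻¹ • (1 - q) * p * ((2 : ℂ)⁻¹ • (1 - q))) := by
      simp only [smul_mul_assoc, mul_smul_comm, add_mul, mul_add, sub_mul, mul_sub, one_mul,
        mul_one]
      module
    rw [this, h0, h1, add_zero, smul_zero]
  have h' : p + q * p * q = 0 := (smul_eq_zero_iff_right two_ne_zero).1 h
  have h'' : (p + q * p * q) * q = 0 := by rw [h', zero_mul]
  rw [add_mul, mul_assoc _ q q, hq, mul_one] at h''
  exact eq_neg_of_add_eq_zero_right h''

theorem genXStar_mul_genX (x : Fin 1 → ℤˣ) : genXStar x * genX x = -(genX x * genXStar x) := by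
  apply mul_eq_neg_mul_of_compressions (genXStar_mul_self x)
  · have h := RingQuot.mkAlgHom_rel ℂ (Rel.triple (Γ := cube 1) (x := x) 0 1 0 (Nat.zero_le _)
      diam_cube_one.ge (Nat.zero_le _) (interNum_cube_one zero_le_one le_rfl zero_le_one))
    rw [map_mul, map_mul, map_zero] at h
    rw [← eStar_cube_one_zero]
    exact h
  · have h := RingQuot.mkAlgHom_rel ℂ (Rel.triple (Γ := cube 1) (x := x) 1 1 1 diam_cube_one.ge
      diam_cube_one.ge diam_cube_one.ge (interNum_cube_one le_rfl le_rfl le_rfl))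
    rw [map_mul, map_mul, map_zero] at h
    rw [← eStar_cube_one_one]
    exact h

/-- Writing `f = (1 ± q)/2`, one has `f p f = 0`, so each compression of `(1 + p)/2` is `f/2`, and
the two `f` sum to `1`. -/
theorem compressions_add_eq_one {B : Type*} [Ring B] [Algebra ℂ B] {p q : B}
    (hq : q * q = 1) (hqp : q * p = -(p * q)) :
    (2 : ℂ) • ((2 : ℂ)⁻¹ • (1 + q) * ((2 : ℂ)⁻¹ • (1 + p)) * ((2 : ℂ)⁻¹ • (1 + q)) +
      (2 : ℂ)⁻¹ • (1 - q) * ((2 : ℂ)⁻¹ • (1 + p)) * ((2 : ℂ)⁻¹ • (1 - q))) = 1 := by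
  simp only [smul_mul_assoc, mul_smul_comm, add_mul, mul_add, sub_mul, mul_sub, one_mul, mul_one,
    hq, hqp, neg_mul, mul_assoc p q q]
  module

theorem u0_cube_one (x : Fin 1 → ℤˣ) : u0 1 x = 1 := by
  rw [u0, Finset.sum_range_succ, Finset.sum_range_one,
    interNum_cube_one zero_le_one zero_le_one zero_le_one,
    interNum_cube_one zero_le_one le_rfl le_rfl, eStar_cube_one_zero, eStar_cube_one_one,
    e_cube_one_zero]
  simpa using compressions_add_eq_one (genXStar_mul_self x) (genXStar_mul_genX x)

theorem u0Dual_cube_one (x : Fin 1 → ℤˣ) : u0Dual 1 x = 1 := by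
  rw [u0Dual, Finset.sum_range_succ, Finset.sum_range_one,
    krein_cube_one zero_le_one zero_le_one zero_le_one,
    krein_cube_one zero_le_one le_rfl le_rfl, e_cube_one_zero, e_cube_one_one,
    eStar_cube_one_zero]
  simpa using compressions_add_eq_one (genX_mul_self x)
    (by rw [genXStar_mul_genX, neg_neg] : genX x * genXStar x = -(genXStar x * genX x))

/-! ### `𝒯_1` as a quaternion algebra. -/

/-- Since `p` anticommutes with `q`, it interchanges the idempotents `(1 ± q)/2` under conjugation.
This gives the triple relations with `i = 1`, `h = j`. -/
theorem compression_eq_zero {B : Type*} [Ring B] [Algebra ℂ B] {p q : B}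
    (hq : q * q = 1) (hqp : q * p = -(p * q)) :
    (2 : ℂ)⁻¹ • (1 + q) * p * ((2 : ℂ)⁻¹ • (1 + q)) = 0 ∧
      (2 : ℂ)⁻¹ • (1 - q) * p * ((2 : ℂ)⁻¹ • (1 - q)) = 0 := by
  simp only [smul_mul_assoc, mul_smul_comm, add_mul, mul_add, sub_mul, mul_sub, one_mul, mul_one,
    hq, hqp, neg_mul, mul_assoc p q q]
  constructor <;> module

/-- Orthogonality of the idempotents `(1 ± q)/2`; the middle factor `1` is the image of `x_0` or
`x_0^*` in the triple relations with `i = 0`, `h ≠ j`. -/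
theorem one_add_mul_one_sub_eq_zero {B : Type*} [Ring B] [Algebra ℂ B] {q : B} (hq : q * q = 1) :
    (2 : ℂ)⁻¹ • (1 + q) * 1 * ((2 : ℂ)⁻¹ • (1 - q)) = 0 ∧
      (2 : ℂ)⁻¹ • (1 - q) * 1 * ((2 : ℂ)⁻¹ • (1 + q)) = 0 := by
  simp only [smul_mul_assoc, mul_smul_comm, add_mul, mul_add, sub_mul, mul_sub, one_mul, mul_one,
    hq]
  constructor <;> module

/-- Two anticommuting involutions satisfy the defining relations of `𝒯_1`. -/
theorem rel_cube_one_of_involutions {B : Type*} [Ring B] [Algebra ℂ B] (x : Fin 1 → ℤˣ)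
    (f : Free (cube 1) →ₐ[ℂ] B) (h0 : f (fX (cube 1) 0) = 1) (h0s : f (fXStar (cube 1) 0) = 1)
    {p q : B} (h1 : f (fX (cube 1) 1) = p) (h1s : f (fXStar (cube 1) 1) = q)
    (hp : p * p = 1) (hq : q * q = 1) (hqp : q * p = -(p * q)) ⦃a b : Free (cube 1)⦄
    (hab : Rel (cube 1) x a b) : f a = f b := by
  have hpq : p * q = -(q * p) := by rw [hqp, neg_neg]
  induction hab with
  | one => rw [h0, map_one]
  | one_star => rw [h0s, map_one]
  | mul i j hi hj =>
    rw [diam_cube_one] at hi hj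
    rw [sum_range_diam_cube_one, interNum_cube_one zero_le_one hi hj,
      interNum_cube_one le_rfl hi hj]
    interval_cases i <;> interval_cases j <;> simp [h0, h1, hp]
  | mul_star i j hi hj =>
    rw [diam_cube_one] at hi hj
    rw [sum_range_diam_cube_one, krein_cube_one zero_le_one hi hj, krein_cube_one le_rfl hi hj]
    interval_cases i <;> interval_cases j <;> simp [h0s, h1s, hq]
  | triple h i j hh hi hj hz =>
    rw [diam_cube_one] at hh hi hj
    replace hz : (h + i + j) % 2 ≠ 0 := fun h0 => by simp [interNum_cube_one hh hi hj, h0] at hz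
    rw [map_mul, map_mul, map_zero]
    -- Only odd `h + i + j` imposes a relation; `omega` discards the even cases.
    interval_cases h <;> interval_cases i <;> interval_cases j <;> first
      | omega
      | (simp only [fEStar_cube_one_zero, fEStar_cube_one_one, map_smul, map_add, map_sub, h0, h0s,
          h1, h1s]
         first
          | exact (compression_eq_zero hq hqp).1
          | exact (compression_eq_zero hq hqp).2
          | exact (one_add_mul_one_sub_eq_zero hq).1
          | exact (one_add_mul_one_sub_eq_zero hq).2)
  | triple_star h i j hh hi hj hz =>
    rw [diam_cube_one] at hh hi hj
    replace hz : (h + i + j) % 2 ≠ 0 := fun h0 => by simp [krein_cube_one hh hi hj, h0] at hz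
    rw [map_mul, map_mul, map_zero]
    interval_cases h <;> interval_cases i <;> interval_cases j <;> first
      | omega
      | (simp only [fE_cube_one_zero, fE_cube_one_one, map_smul, map_add, map_sub, h0, h0s,
          h1, h1s]
         first
          | exact (compression_eq_zero hp hpq).1
          | exact (compression_eq_zero hp hpq).2
          | exact (one_add_mul_one_sub_eq_zero hp).1
          | exact (one_add_mul_one_sub_eq_zero hp).2)

/-- A pair of anticommuting involutions as a basis of quaternion type. -/
def quaternionBasisOfInvolutions {B : Type*} [Ring B] [Algebra ℂ B] {p q : B}
    (hp : p * p = 1) (hq : q * q = 1) (hqp : q * p = -(p * q)) :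
    QuaternionAlgebra.Basis B (1 : ℂ) 0 1 where
  i := p
  j := q
  k := p * q
  i_mul_i := by simp [hp]
  j_mul_j := by simp [hq]
  i_mul_j := rfl
  j_mul_i := by simp [hqp]

/-- The images of the generators under the map from the free algebra to the quaternion algebra. -/
def quaternionGen : Fin ((cube 1).diam + 1) ⊕ Fin ((cube 1).diam + 1) →
    QuaternionAlgebra ℂ (1 : ℂ) 0 1
  | .inl i => if i.val = 0 then 1 else ⟨0, 1, 0, 0⟩
  | .inr i => if i.val = 0 then 1 else ⟨0, 0, 1, 0⟩

theorem lift_quaternionGen_fX (i : ℕ) (hi : i ≤ 1) :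
    FreeAlgebra.lift ℂ quaternionGen (fX (cube 1) i) = if i = 0 then 1 else ⟨0, 1, 0, 0⟩ := by
  rw [fX, dif_pos (by rw [diam_cube_one]; omega), FreeAlgebra.lift_ι_apply, quaternionGen]

theorem lift_quaternionGen_fXStar (i : ℕ) (hi : i ≤ 1) :
    FreeAlgebra.lift ℂ quaternionGen (fXStar (cube 1) i) = if i = 0 then 1 else ⟨0, 0, 1, 0⟩ := by
  rw [fXStar, dif_pos (by rw [diam_cube_one]; omega), FreeAlgebra.lift_ι_apply, quaternionGen]

/-- The homomorphism from `𝒯_1` to the quaternion algebra with `i² = j² = 1`. -/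
noncomputable def toQuaternion (x : Fin 1 → ℤˣ) :
    cubeAlg 1 x →ₐ[ℂ] QuaternionAlgebra ℂ (1 : ℂ) 0 1 :=
  RingQuot.liftAlgHom ℂ ⟨FreeAlgebra.lift ℂ quaternionGen,
    rel_cube_one_of_involutions x _ (lift_quaternionGen_fX 0 zero_le_one)
      (lift_quaternionGen_fXStar 0 zero_le_one) (lift_quaternionGen_fX 1 le_rfl)
      (lift_quaternionGen_fXStar 1 le_rfl) (by ext <;> simp) (by ext <;> simp)
      (by ext <;> simp)⟩

/-- The homomorphism from the quaternion algebra with `i² = j² = 1` to `𝒯_1`. -/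
noncomputable def ofQuaternion (x : Fin 1 → ℤˣ) :
    QuaternionAlgebra ℂ (1 : ℂ) 0 1 →ₐ[ℂ] cubeAlg 1 x :=
  (quaternionBasisOfInvolutions (genX_mul_self x) (genXStar_mul_self x)
    (genXStar_mul_genX x)).liftHom

theorem ofQuaternion_i (x : Fin 1 → ℤˣ) : ofQuaternion x ⟨0, 1, 0, 0⟩ = genX x := by
  simp [ofQuaternion, quaternionBasisOfInvolutions, QuaternionAlgebra.Basis.lift]

theorem ofQuaternion_j (x : Fin 1 → ℤˣ) : ofQuaternion x ⟨0, 0, 1, 0⟩ = genXStar x := by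
  simp [ofQuaternion, quaternionBasisOfInvolutions, QuaternionAlgebra.Basis.lift]

theorem toQuaternion_genX (x : Fin 1 → ℤˣ) : toQuaternion x (genX x) = ⟨0, 1, 0, 0⟩ := by
  rw [toQuaternion, genX, RingQuot.liftAlgHom_mkAlgHom_apply, lift_quaternionGen_fX 1 le_rfl,
    if_neg one_ne_zero]

theorem toQuaternion_genXStar (x : Fin 1 → ℤˣ) :
    toQuaternion x (genXStar x) = ⟨0, 0, 1, 0⟩ := by
  rw [toQuaternion, genXStar, RingQuot.liftAlgHom_mkAlgHom_apply,
    lift_quaternionGen_fXStar 1 le_rfl, if_neg one_ne_zero]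

/-- `x_0` and `x_0^*` are identified with `1`, so `x_1` and `x_1^*` generate. -/
theorem cubeAlg_one_hom_ext {B : Type*} [Ring B] [Algebra ℂ B] {x : Fin 1 → ℤˣ}
    {f g : cubeAlg 1 x →ₐ[ℂ] B} (h : f (genX x) = g (genX x))
    (hs : f (genXStar x) = g (genXStar x)) : f = g := by
  apply RingQuot.ringQuot_ext'
  apply FreeAlgebra.hom_ext
  funext s
  have hX (i : Fin ((cube 1).diam + 1)) :
      FreeAlgebra.ι ℂ (Sum.inl i) = fX (cube 1) i.val := by rw [fX, dif_pos i.isLt]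
  have hXs (i : Fin ((cube 1).diam + 1)) :
      FreeAlgebra.ι ℂ (Sum.inr i) = fXStar (cube 1) i.val := by rw [fXStar, dif_pos i.isLt]
  have hlt (i : Fin ((cube 1).diam + 1)) : i.val = 0 ∨ i.val = 1 := by
    have := i.isLt
    have := diam_cube_one
    omega
  rcases s with i | i
  · simp only [Function.comp_apply, AlgHom.comp_apply, hX]
    rcases hlt i with hi | hi <;> rw [hi]
    · rw [mkAlgHom_fX_zero, map_one, map_one]
    · exact h
  · simp only [Function.comp_apply, AlgHom.comp_apply, hXs]
    rcases hlt i with hi | hi <;> rw [hi]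
    · rw [mkAlgHom_fXStar_zero, map_one, map_one]
    · exact hs

/-- `𝒯_1` is the quaternion algebra with `i² = j² = 1`. -/
noncomputable def cubeAlgOneEquivQuaternion (x : Fin 1 → ℤˣ) :
    cubeAlg 1 x ≃ₐ[ℂ] QuaternionAlgebra ℂ (1 : ℂ) 0 1 :=
  AlgEquiv.ofAlgHom (toQuaternion x) (ofQuaternion x)
    (QuaternionAlgebra.hom_ext
      (by
        change toQuaternion x (ofQuaternion x ⟨0, 1, 0, 0⟩) = ⟨0, 1, 0, 0⟩
        rw [ofQuaternion_i, toQuaternion_genX])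
      (by
        change toQuaternion x (ofQuaternion x ⟨0, 0, 1, 0⟩) = ⟨0, 0, 1, 0⟩
        rw [ofQuaternion_j, toQuaternion_genXStar]))
    (cubeAlg_one_hom_ext
      (by rw [AlgHom.comp_apply, toQuaternion_genX, ofQuaternion_i, AlgHom.id_apply])
      (by rw [AlgHom.comp_apply, toQuaternion_genXStar, ofQuaternion_j, AlgHom.id_apply]))

/-! ### Splitting the quaternion algebra. -/

/-- The homomorphism from the quaternion algebra with `i² = j² = 1` to `M_2(ℂ)`. -/
noncomputable def quaternionToMatrix :
    QuaternionAlgebra ℂ (1 : ℂ) 0 1 →ₐ[ℂ] Matrix (Fin 2) (Fin 2) ℂ :=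
  (quaternionBasisOfInvolutions (p := (!![0, 1; 1, 0] : Matrix (Fin 2) (Fin 2) ℂ))
    (q := !![1, 0; 0, -1]) (by simp [Matrix.one_fin_two]) (by simp [Matrix.one_fin_two])
    (by simp)).liftHom

theorem quaternionToMatrix_apply (w : QuaternionAlgebra ℂ (1 : ℂ) 0 1) :
    quaternionToMatrix w =
      !![w.re + w.imJ, w.imI - w.imK; w.imI + w.imK, w.re - w.imJ] := by
  ext a b
  fin_cases a <;> fin_cases b <;>
    simp [quaternionToMatrix, quaternionBasisOfInvolutions, QuaternionAlgebra.Basis.lift,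
      Matrix.algebraMap_matrix_apply, sub_eq_add_neg]

theorem quaternionToMatrix_bijective : Function.Bijective quaternionToMatrix := by
  constructor
  · rw [injective_iff_map_eq_zero]
    intro w hw
    rw [quaternionToMatrix_apply] at hw
    have h00 := congrFun₂ hw 0 0
    have h01 := congrFun₂ hw 0 1
    have h10 := congrFun₂ hw 1 0
    have h11 := congrFun₂ hw 1 1
    simp at h00 h01 h10 h11
    ext <;> simp only [QuaternionAlgebra.re_zero, QuaternionAlgebra.imI_zero,
      QuaternionAlgebra.imJ_zero, QuaternionAlgebra.imK_zero]
    · linear_combination h00 / 2 + h11 / 2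
    · linear_combination h01 / 2 + h10 / 2
    · linear_combination h00 / 2 - h11 / 2
    · linear_combination h10 / 2 - h01 / 2
  · intro m
    -- Half-sums and half-differences of entries invert `quaternionToMatrix_apply`.
    refine ⟨⟨(m 0 0 + m 1 1) / 2, (m 0 1 + m 1 0) / 2, (m 0 0 - m 1 1) / 2,
      (m 1 0 - m 0 1) / 2⟩, ?_⟩
    rw [quaternionToMatrix_apply]
    ext a b
    fin_cases a <;> fin_cases b <;> simp <;> ring

end GenTerwilliger

theorem mainTheorem8 (x : Fin 1 → ℤˣ) :
    (GenTerwilliger.u0 1 x = 1 ∧ GenTerwilliger.u0Dual 1 x = 1) ∧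
      Nonempty (GenTerwilliger.cubeAlg 1 x ≃ₐ[ℂ] Matrix (Fin 2) (Fin 2) ℂ) :=
  ⟨⟨GenTerwilliger.u0_cube_one x, GenTerwilliger.u0Dual_cube_one x⟩,
    ⟨(GenTerwilliger.cubeAlgOneEquivQuaternion x).trans
      (AlgEquiv.ofBijective _ GenTerwilliger.quaternionToMatrix_bijective)⟩⟩
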